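/- Consider a game of $T$ rounds with action set $[n]$. Before the game an oblivious adversary fixes reward functions $r_1,\dots,r_T:[n]\to[0,1]$. On round $t$ the player chooses an action $X_t\in[n]$, possibly at random, on the basis of the feedback of the previous rounds, and observes only the reward $r_t(X_t)$. A reactive policy $\pi$ over $n$ actions is given by an initial action $x_1^\pi\in[n]$ and a function $\pi:[0,1]\to[n]$. Had it been followed from the beginning, it would play $x_1^\pi$ on round $1$ and $x_{t+1}^\pi=\pi(r_t(x_t^\pi))$ on round $t+1$. (It is a finite state machine with $S=n$ states whose action function is the identity and whose transitions depend only on the last observed reward.) The expected regret of the player with respect to a finite set $\Pi$ of policies is $$\mathrm{Regret}_T=\max_{\pi\in\Pi}\sum_{t=1}^T r_t(x_t^\pi)-\mathbf E\Big[\sum_{t=1}^T r_t(X_t)\Big].$$ **Theorem 2.** There are a set $\Pi$ of $k=3$ distinct reactive policies over $n=3$ actions (hence with $S=3$ states) and a constant $c>0$ such that for every $T\ge 2$ and every randomized player algorithm (which may depend on $T$ and $\Pi$) there is an oblivious sequence of reward functions $r_1,\dots,r_T:[3]\to[0,1]$ on which the expected regret with respect to $\Pi$ satisfies $$\mathrm{Regret}_T\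 \ge\ c\,\frac{T}{\log^{3/2}T}.$$ In particular, no player algorithm can guarantee expected regret $o(T/\log^{3/2}T)$ with respect to every set of three reactive policies over three actions. Moreover, such a lower bound holds for the set $\Pi=\{\pi_1,\pi_2,\pi_3\}$ of the commute example, in which $\pi_i$ starts with action $i$ and all three policies share the function $$g(x)=\begin{cases}1 & \text{if } |x-\tfrac12|\le\tfrac16,\\ 2 & \text{if } |x-\tfrac12|>\tfrac13,\\ 3 & \text{otherwise.}\end{cases}$$ -/

import Mathlib

open MeasureTheory

universe u

noncomputable section

/-- A stateful policy over `n` actions and `S` states: a finite state machine with an initial state,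
an action function, and a transition function driven by the last observed reward in `[0,1]`. -/
structure StatefulPolicy (n S : ℕ) where
  init : Fin S
  act : Fin S → Fin n
  trans : Fin S → unitInterval → Fin S

/-- An oblivious sequence of reward functions; `r t x` is the reward of action `x` on the round with
index `t`. Rounds are indexed from `0`, so a game of `T` rounds only involves `t < T`. -/
abbrev RewardSeq (n : ℕ) : Type := ℕ → Fin n → unitInterval

/-- The state in which the policy enters round `t`, had it been followed from the beginning. -/
def StatefulPolicy.state {n S : ℕ} (p : StatefulPolicy n S) (r : RewardSeq n) : ℕ → Fin S
  | 0 => p.init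
  | t + 1 => p.trans (p.state r t) (r t (p.act (p.state r t)))

/-- The action played by the policy on round `t`, had it been followed from the beginning. -/
def StatefulPolicy.action {n S : ℕ} (p : StatefulPolicy n S) (r : RewardSeq n) (t : ℕ) : Fin n :=
  p.act (p.state r t)

/-- The total reward collected by the policy in rounds `0, …, T - 1`. -/
def StatefulPolicy.total {n S : ℕ} (p : StatefulPolicy n S) (r : RewardSeq n) (T : ℕ) : ℝ :=
  ∑ t ∈ Finset.range T, (r t (p.action r t) : ℝ)

/-- A reactive policy over `n` actions (with 1-lookback): an initial action, and a function mapping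
the last observed reward to the next action. -/
structure ReactivePolicy (n : ℕ) where
  init : Fin n
  next : unitInterval → Fin n

/-- A reactive policy as a stateful policy with `n` states: the action function is the identity and
the transition function ignores the current state. -/
def ReactivePolicy.toStateful {n : ℕ} (p : ReactivePolicy n) : StatefulPolicy n n where
  init := p.init
  act := id
  trans := fun _ x => p.next x

/-- A randomized player algorithm over `n` actions under bandit feedback. The internal randomness is
a point `ω` of a probability space. Given `ω` and what was observed in the previous rounds (the list,
in chronological order, of the actions played and the rewards received for them), `choose` is the
action played on the present round, whose index is the length of the list. -/
structure PlayerAlgorithm (n : ℕ) where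
  Ω : Type u
  [mΩ : MeasurableSpace Ω]
  μ : Measure Ω
  [prob : IsProbabilityMeasure μ]
  choose : Ω → List (Fin n × unitInterval) → Fin n
  measurable_choose : ∀ h : List (Fin n × unitInterval), Measurable fun ω => choose ω h

attribute [instance] PlayerAlgorithm.mΩ PlayerAlgorithm.prob

/-- What the player has observed before round `t`. -/
def PlayerAlgorithm.history {n : ℕ} (A : PlayerAlgorithm n) (r : RewardSeq n) (ω : A.Ω) :
    ℕ → List (Fin n × unitInterval)
  | 0 => []
  | t + 1 =>
    A.history r ω t ++
      [(A.choose ω (A.history r ω t), r t (A.choose ω (A.history r ω t)))]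

/-- The action `X_t` played by the algorithm on round `t`. -/
def PlayerAlgorithm.action {n : ℕ} (A : PlayerAlgorithm n) (r : RewardSeq n) (t : ℕ) (ω : A.Ω) :
    Fin n :=
  A.choose ω (A.history r ω t)

/-- The expected regret over `T` rounds with respect to the reference policies `P 0, …, P (k-1)`
(for `k ≥ 1` the supremum is a maximum over a finite nonempty set). -/
def expectedRegret {n S k : ℕ} (P : Fin k → StatefulPolicy n S) (A : PlayerAlgorithm n)
    (r : RewardSeq n) (T : ℕ) : ℝ :=
  (⨆ i, (P i).total r T) - ∫ ω, ∑ t ∈ Finset.range T, (r t (A.action r t ω) : ℝ) ∂A.μ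

/-- The three policies of the commute example, over the three actions (routes) `0, 1, 2`, which stand
for the routes 1, 2, 3. They differ only in the initial action `i`. After a reward `x` the next route
is the first if `|x - 1/2| ≤ 1/6`, the second if `|x - 1/2| > 1/3`, and the third otherwise. -/
def commutePolicy (i : Fin 3) : ReactivePolicy 3 where
  init := i
  next := fun x =>
    if |(x : ℝ) - 1 / 2| ≤ 1 / 6 then 0 else if 1 / 3 < |(x : ℝ) - 1 / 2| then 1 else 2

end

/-! By the minimax principle it suffices to give one random instance that is bad for every
deterministic player. Three tokens sit on the three actions and are permuted afresh each round. The
reward at a token encodes its next place coarsely, so each policy follows one token. A fine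
perturbation adds a common offset, plus one unit at token `0`. The policy following token `0` is the
benchmark.

The offset hides the extra unit. It sums independent geometric noise over the nodes of a dyadic tree
above the current round. If the player sits on token `0` during rounds `s..t`, exchange that token
with another from round `s` on and raise the offset by one from `s` on: all observations are the
same, but the player is now off token `0`. The raise alters at most `L + 1` nodes, each at
likelihood cost `q`, with `q ^ (L + 1) ≥ 1/2`. This exchange is injective, so the player is off
token `0` with probability at least `1/6` on each round (`sum_weight_played_ne_zero_ge`).

The coarse parts cancel by symmetry (`sum_weight_routeCenter_sub`). With `1 - q` of order `1 / L`,
the offset has standard deviation of order `L ^ (3/2)`. Scaling by that size to fit the unit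
interval leaves a loss of order `L ^ (-3/2)` per round, with `L` about `log T`. -/

section GeometricNoise

/-! ### Second moment of truncated geometric noise. -/

/-- Geometric weights on `{0, …, N}`, normalized to a probability vector. -/
noncomputable def truncGeom (q : ℝ) (N : ℕ) (a : Fin (N + 1)) : ℝ :=
  q ^ (a : ℕ) / ∑ b : Fin (N + 1), q ^ (b : ℕ)

variable {q : ℝ} {N : ℕ}

lemma one_le_sum_fin_pow (hq : 0 < q) : 1 ≤ ∑ b : Fin (N + 1), q ^ (b : ℕ) := by
  rw [Fin.sum_univ_succ]
  have : 0 ≤ ∑ i : Fin N, q ^ ((i.succ : Fin (N + 1)) : ℕ) :=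
    Finset.sum_nonneg fun i _ => by positivity
  simpa using this

lemma truncGeom_pos (hq : 0 < q) (a : Fin (N + 1)) : 0 < truncGeom q N a :=
  div_pos (pow_pos hq _) (zero_lt_one.trans_le (one_le_sum_fin_pow hq))

lemma sum_truncGeom (hq : 0 < q) : ∑ a, truncGeom q N a = 1 := by
  unfold truncGeom
  rw [← Finset.sum_div]
  exact div_self (zero_lt_one.trans_le (one_le_sum_fin_pow hq)).ne'

lemma truncGeom_last_le (hq : 0 < q) : truncGeom q N (Fin.last N) ≤ q ^ N := by
  unfold truncGeom
  rw [Fin.val_last]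
  exact div_le_self (by positivity) (one_le_sum_fin_pow hq)

/-- This constant likelihood ratio is the reason for geometric noise. -/
lemma truncGeom_add_one {a : Fin (N + 1)} (ha : a ≠ Fin.last N) :
    truncGeom q N (a + 1) = q * truncGeom q N a := by
  unfold truncGeom
  rw [Fin.val_add_one_of_lt (Fin.lt_last_iff_ne_last.2 ha), pow_succ]
  ring

/-- Summation by parts; keeping the boundary term lets the induction close. -/
lemma sum_mul_geom_le (hq : 0 < q) (hq1 : q < 1) (n : ℕ) :
    (1 - q) * ∑ a ∈ Finset.range n, (a : ℝ) * q ^ a + n * q ^ n ≤ ∑ a ∈ Finset.range n, q ^ a := by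
  induction n with
  | zero => simp
  | succ n ih =>
    rw [Finset.sum_range_succ, Finset.sum_range_succ]
    push_cast
    have h : q ^ (n + 1) ≤ q ^ n := pow_le_pow_of_le_one hq.le hq1.le n.le_succ
    have e : q ^ (n + 1) = q * q ^ n := by ring
    rw [e] at h ⊢
    linarith

lemma sum_sq_mul_geom_le (hq : 0 < q) (hq1 : q < 1) (n : ℕ) :
    (1 - q) * ∑ a ∈ Finset.range n, (a : ℝ) ^ 2 * q ^ a + (n : ℝ) ^ 2 * q ^ n ≤
      2 * ∑ a ∈ Finset.range n, (a : ℝ) * q ^ a + ∑ a ∈ Finset.range n, q ^ a := by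
  induction n with
  | zero => simp
  | succ n ih =>
    rw [Finset.sum_range_succ, Finset.sum_range_succ, Finset.sum_range_succ]
    push_cast
    have h : q ^ (n + 1) ≤ q ^ n := pow_le_pow_of_le_one hq.le hq1.le n.le_succ
    have h2 : (2 * n + 1) * q ^ (n + 1) ≤ (2 * n + 1) * q ^ n :=
      mul_le_mul_of_nonneg_left h (by positivity)
    have e : q ^ (n + 1) = q * q ^ n := by ring
    rw [e] at h2 ⊢
    linarith

lemma truncGeom_second_moment_le (hq : 0 < q) (hq1 : q < 1) :
    ∑ a, truncGeom q N a * ((a : ℕ) : ℝ) ^ 2 ≤ 3 / (1 - q) ^ 2 := by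
  have hZ := zero_lt_one.trans_le (one_le_sum_fin_pow (N := N) hq)
  have h1 := sum_mul_geom_le hq hq1 (N + 1)
  have h2 := sum_sq_mul_geom_le hq hq1 (N + 1)
  have e : ∑ a, truncGeom q N a * ((a : ℕ) : ℝ) ^ 2 =
      (∑ a ∈ Finset.range (N + 1), (a : ℝ) ^ 2 * q ^ a) / ∑ b : Fin (N + 1), q ^ (b : ℕ) := by
    rw [← Fin.sum_univ_eq_sum_range (fun a => (a : ℝ) ^ 2 * q ^ a), Finset.sum_div]
    refine Finset.sum_congr rfl fun a _ => ?_
    unfold truncGeom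
    ring
  have hq' : 0 < 1 - q := by linarith
  rw [e, div_le_div_iff₀ hZ (by positivity)]
  rw [Fin.sum_univ_eq_sum_range (fun a => q ^ a)] at hZ ⊢
  set S0 := ∑ a ∈ Finset.range (N + 1), q ^ a
  set S1 := ∑ a ∈ Finset.range (N + 1), (a : ℝ) * q ^ a
  set S2 := ∑ a ∈ Finset.range (N + 1), (a : ℝ) ^ 2 * q ^ a
  have p1 : 0 ≤ ((N + 1 : ℕ) : ℝ) * q ^ (N + 1) := by positivity
  have p2 : 0 ≤ ((N + 1 : ℕ) : ℝ) ^ 2 * q ^ (N + 1) := by positivity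
  have h3 : (1 - q) * S2 ≤ 2 * S1 + S0 := by linarith
  have h4 : (1 - q) * ((1 - q) * S2) ≤ (1 - q) * (2 * S1 + S0) :=
    mul_le_mul_of_nonneg_left h3 hq'.le
  nlinarith [mul_pos hq hZ]

end GeometricNoise

/-! ### Expectations under product weights. -/

section ProductWeights

variable {V α : Type*} [Fintype V] [DecidableEq V] [Fintype α] (p : α → ℝ)

lemma sum_prod_weights_mul (f : V → α → ℝ) :
    ∑ ξ : V → α, (∏ v, p (ξ v)) * ∏ v, f v (ξ v) = ∏ v, ∑ a, p a * f v a := by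
  rw [Finset.prod_univ_sum, Fintype.piFinset_univ]
  exact Finset.sum_congr rfl fun ξ _ => Finset.prod_mul_distrib.symm

variable {p}

lemma sum_prod_weights (hp : ∑ a, p a = 1) : ∑ ξ : V → α, ∏ v, p (ξ v) = 1 := by
  simpa [hp] using sum_prod_weights_mul (V := V) p fun _ _ => 1

lemma sum_prod_weights_coord (hp : ∑ a, p a = 1) (v : V) (g : α → ℝ) :
    ∑ ξ : V → α, (∏ v, p (ξ v)) * g (ξ v) = ∑ a, p a * g a := by
  have h := sum_prod_weights_mul (V := V) p fun u a => if u = v then g a else 1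
  have e : ∀ u : V, ∑ a, p a * (if u = v then g a else 1) =
      if u = v then ∑ a, p a * g a else 1 := by
    intro u
    split_ifs <;> simp [hp]
  simp_rw [e] at h
  simpa [Finset.prod_ite_eq'] using h

lemma sum_prod_weights_coord_mul_coord {v w : V} (hvw : v ≠ w) {g : α → ℝ}
    (hg : ∑ a, p a * g a = 0) :
    ∑ ξ : V → α, (∏ v, p (ξ v)) * (g (ξ v) * g (ξ w)) = 0 := by
  have h := sum_prod_weights_mul (V := V) p
    fun u a => (if u = v then g a else 1) * (if u = w then g a else 1)
  rw [Finset.prod_eq_zero (Finset.mem_univ v)] at h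
  · simp_rw [Finset.prod_mul_distrib, Finset.prod_ite_eq'] at h
    simpa using h
  · simpa [hvw] using hg

lemma sum_prod_weights_sq_sum {ι : Type*} [Fintype ι] (hp : ∑ a, p a = 1) {g : α → ℝ}
    (hg : ∑ a, p a * g a = 0) {node : ι → V} (hnode : Function.Injective node) :
    ∑ ξ : V → α, (∏ v, p (ξ v)) * (∑ i, g (ξ (node i))) ^ 2 =
      Fintype.card ι * ∑ a, p a * g a ^ 2 := by
  classical
  have e : ∀ i j, ∑ ξ : V → α, (∏ v, p (ξ v)) * (g (ξ (node i)) * g (ξ (node j))) =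
      if i = j then ∑ a, p a * g a ^ 2 else 0 := by
    intro i j
    split_ifs with h
    · subst h
      simpa [sq] using sum_prod_weights_coord hp (node i) fun a => g a * g a
    · exact sum_prod_weights_coord_mul_coord (fun h' => h (hnode h')) hg
  calc _ = ∑ ξ : V → α, ∑ i, ∑ j, (∏ v, p (ξ v)) * (g (ξ (node i)) * g (ξ (node j))) := by
        refine Finset.sum_congr rfl fun ξ _ => ?_
        rw [sq, Finset.sum_mul_sum, Finset.mul_sum]
        exact Finset.sum_congr rfl fun i _ => Finset.mul_sum _ _ _
    _ = ∑ i, ∑ j, ∑ ξ : V → α, (∏ v, p (ξ v)) * (g (ξ (node i)) * g (ξ (node j))) := by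
        rw [Finset.sum_comm]
        exact Finset.sum_congr rfl fun i _ => Finset.sum_comm
    _ = _ := by simp [e]

/-- The variance of a sum of independent coordinates is at most the sum of the second moments. -/
lemma sum_prod_weights_variance_le {ι : Type*} [Fintype ι] (hp : ∑ a, p a = 1) (g : α → ℝ)
    {node : ι → V} (hnode : Function.Injective node) :
    ∑ ξ : V → α, (∏ v, p (ξ v)) *
        (∑ i, g (ξ (node i)) - Fintype.card ι * ∑ a, p a * g a) ^ 2 ≤
      Fintype.card ι * ∑ a, p a * g a ^ 2 := by
  set μ := ∑ a, p a * g a with hμ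
  have h0 : ∑ a, p a * (g a - μ) = 0 := by
    simp [mul_sub, Finset.sum_sub_distrib, ← Finset.sum_mul, hp, hμ]
  have h := sum_prod_weights_sq_sum hp h0 hnode
  have e : ∑ a, p a * (g a - μ) ^ 2 = ∑ a, p a * g a ^ 2 - μ ^ 2 := by
    have : ∀ a, p a * (g a - μ) ^ 2 = p a * g a ^ 2 - 2 * μ * (p a * g a) + μ ^ 2 * p a :=
      fun a => by ring
    simp_rw [this, Finset.sum_add_distrib, Finset.sum_sub_distrib, ← Finset.mul_sum, hp, ← hμ]
    ring
  simp only [Finset.sum_sub_distrib, Finset.sum_const, Finset.card_univ, nsmul_eq_mul] at h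
  rw [h, e]
  exact mul_le_mul_of_nonneg_left (by nlinarith [sq_nonneg μ]) (by positivity)

end ProductWeights

/-! ### Dyadic decomposition of a final segment of rounds. -/

section DyadicTree

/-- The node at level `l` of the dyadic tree of depth `L` whose interval
`[v * 2 ^ l, (v + 1) * 2 ^ l)` contains `t` (meaningful for `t < 2 ^ L`). -/
def dyadicNode (L t : ℕ) (l : Fin (L + 1)) : Fin (L + 1) × Fin (2 ^ L) :=
  (l, Fin.ofNat (2 ^ L) (t / 2 ^ (l : ℕ)))

lemma dyadicNode_injective (L t : ℕ) : Function.Injective (dyadicNode L t) :=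
  fun _ _ h => congrArg Prod.fst h

/-- The maximal dyadic intervals contained in `[s, 2 ^ L)`. -/
def IsMaximalAfter (L s : ℕ) (v : Fin (L + 1) × Fin (2 ^ L)) : Prop :=
  s ≤ (v.2 : ℕ) * 2 ^ (v.1 : ℕ) ∧
    -- Otherwise the parent must start before `s`. The root level has no parent, so its superfluous
    -- indices are excluded by hand.
    if (v.1 : ℕ) = L then (v.2 : ℕ) = 0 else (v.2 : ℕ) / 2 * 2 ^ ((v.1 : ℕ) + 1) < s

instance (L s : ℕ) : DecidablePred (IsMaximalAfter L s) := fun v => by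
  unfold IsMaximalAfter; infer_instance

/-- There is at most one such node per level: of two intervals after `s`, the parent of the later
one starts no earlier than the first. -/
lemma card_isMaximalAfter_le (L s : ℕ) :
    (Finset.univ.filter (IsMaximalAfter L s)).card ≤ L + 1 := by
  have key : ∀ l a b : ℕ, s ≤ a * 2 ^ l → b / 2 * 2 ^ (l + 1) < s → b ≤ a := by
    intro l a b h1 h2
    by_contra! h
    have h3 : a ≤ b / 2 * 2 := by omega
    have := Nat.mul_le_mul_right (2 ^ l) h3
    rw [pow_succ'] at h2
    rw [mul_assoc] at this
    omega
  have h : Set.InjOn Prod.fst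
      (Finset.univ.filter (IsMaximalAfter L s) : Set (Fin (L + 1) × Fin (2 ^ L))) := by
    rintro ⟨l, a⟩ ha ⟨l', b⟩ hb (rfl : l = l')
    simp only [Finset.coe_filter, Finset.mem_univ, true_and, Set.mem_ofPred_eq,
      IsMaximalAfter] at ha hb
    ext
    · rfl
    · simp only
      split_ifs at ha hb with hl
      · omega
      · exact le_antisymm (key _ _ _ hb.1 ha.2) (key _ _ _ ha.1 hb.2)
  simpa using Finset.card_le_card_of_injOn Prod.fst (fun _ _ => Finset.mem_univ _) h

/-- The ancestors of `t` that start at or after `s` form an initial stretch of its path, and only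
the top one is maximal; hence the telescoping. -/
lemma sum_isMaximalAfter_path {L s t : ℕ} (ht : t < 2 ^ L) :
    ∑ l, (if IsMaximalAfter L s (dyadicNode L t l) then 1 else 0 : ℝ) = if s ≤ t then 1 else 0 := by
  let a : ℕ → ℝ := fun l => if s ≤ t / 2 ^ l * 2 ^ l then 1 else 0
  have hval : ∀ l : Fin (L + 1), ((dyadicNode L t l).2 : ℕ) = t / 2 ^ (l : ℕ) := fun l => by
    have : t / 2 ^ (l : ℕ) < 2 ^ L := (Nat.div_le_self _ _).trans_lt ht
    simp [dyadicNode, Fin.ofNat, Nat.mod_eq_of_lt this]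
  have hfst : ∀ l : Fin (L + 1), ((dyadicNode L t l).1 : ℕ) = l := fun l => rfl
  have h1 : ∀ l : Fin L, (if IsMaximalAfter L s (dyadicNode L t l.castSucc) then 1 else 0 : ℝ) =
      a l - a (l + 1) := by
    intro l
    have hl : (l : ℕ) ≠ L := l.2.ne
    have hle : t / 2 ^ (l : ℕ) / 2 * 2 ^ ((l : ℕ) + 1) ≤ t / 2 ^ (l : ℕ) * 2 ^ (l : ℕ) := by
      rw [pow_succ', ← mul_assoc]
      exact Nat.mul_le_mul_right _ (Nat.div_mul_le_self _ _)
    have hd : t / 2 ^ ((l : ℕ) + 1) = t / 2 ^ (l : ℕ) / 2 := by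
      rw [pow_succ, Nat.div_div_eq_div_mul]
    simp only [IsMaximalAfter, hval, hfst, Fin.val_castSucc, if_neg hl, a, hd]
    split_ifs <;> first | omega | norm_num
  have h2 : (if IsMaximalAfter L s (dyadicNode L t (Fin.last L)) then 1 else 0 : ℝ) = a L := by
    simp [IsMaximalAfter, hval, hfst, a, Nat.div_eq_of_lt ht]
  rw [Fin.sum_univ_castSucc, h2, Finset.sum_congr rfl fun l _ => h1 l,
    Fin.sum_univ_eq_sum_range (fun l => a l - a (l + 1)), Finset.sum_range_sub']
  simp [a]

end DyadicTree

/-! ### Token rewards and the undetectable exchange. -/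

section HiddenTokens

/-- A reward in the middle of the range that makes the commute policies move to a given action. -/
noncomputable def routeCenter : Fin 3 → ℝ := ![1 / 2, 11 / 12, 3 / 4]

/-- Truncation of a real number to `[-1, 1]`. -/
noncomputable def clampUnit (z : ℝ) : ℝ := max (-1) (min 1 z)

lemma abs_clampUnit_le (z : ℝ) : |clampUnit z| ≤ 1 := by
  rw [abs_le]
  exact ⟨le_max_left _ _, max_le (by norm_num) (min_le_left _ _)⟩

lemma clampUnit_mono : Monotone clampUnit := fun _ _ h => by
  unfold clampUnit; gcongr

lemma clampUnit_of_abs_le {z : ℝ} (h : |z| ≤ 1) : clampUnit z = z := by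
  rw [abs_le] at h
  rw [clampUnit, min_eq_right h.2, max_eq_right h.1]

/-- The increment of the truncation is that of the identity, up to a Chebyshev-type error. -/
lemma clampUnit_increment_ge {D : ℝ} (hD : 0 < D) (y : ℝ) :
    1 / (1 + D) * (1 - y ^ 2 / D ^ 2) ≤
      clampUnit ((y + 1) / (1 + D)) - clampUnit ((y + 0) / (1 + D)) := by
  rw [add_zero]
  by_cases hy : |y| ≤ D
  · rw [clampUnit_of_abs_le, clampUnit_of_abs_le, ← sub_div, add_sub_cancel_left]
    · exact mul_le_of_le_one_right (by positivity) (sub_le_self _ (by positivity))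
    all_goals
      rw [abs_div, abs_of_pos (by positivity : 0 < 1 + D)]
      refine (div_le_one (by positivity)).2 ?_
    · linarith
    · exact (abs_add_le _ _).trans (by rw [abs_one]; linarith)
  · have h1 : 1 ≤ y ^ 2 / D ^ 2 := by
      rw [one_le_div (by positivity), ← sq_abs y]
      exact pow_le_pow_left₀ hD.le (not_le.1 hy).le 2
    have h2 : clampUnit (y / (1 + D)) ≤ clampUnit ((y + 1) / (1 + D)) :=
      clampUnit_mono (by gcongr; linarith)
    have h3 : 1 / (1 + D) * (1 - y ^ 2 / D ^ 2) ≤ 0 :=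
      mul_nonpos_of_nonneg_of_nonpos (by positivity) (by linarith)
    linarith

lemma routeCenter_add_mem (a : Fin 3) (z : ℝ) :
    routeCenter a + clampUnit z / 24 ∈ Set.Icc (0 : ℝ) 1 := by
  have h := abs_le.1 (abs_clampUnit_le z)
  fin_cases a <;> simp [routeCenter] <;> constructor <;> linarith

/-- Three tokens move between the three actions, token `i` being at `P t i` on round `t`. The reward
at token `i` makes the commute policies follow the token; up to truncation and scaling by `R`, it is
shifted by `Y t`, and by one more unit at token `0`. -/
noncomputable def tokenReward (P : ℕ → Equiv.Perm (Fin 3)) (Y : ℕ → ℝ) (R : ℝ) : RewardSeq 3 :=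
  fun t x => ⟨routeCenter (P (t + 1) ((P t).symm x)) +
    clampUnit ((Y t + if (P t).symm x = 0 then 1 else 0) / R) / 24, routeCenter_add_mem _ _⟩

variable {P P' : ℕ → Equiv.Perm (Fin 3)} {Y Y' : ℕ → ℝ} {R : ℝ}

/-- Each center is at least `1/12` away from the thresholds of the policy, and the perturbation is
at most `1/24`. -/
lemma commutePolicy_next_routeCenter (i a : Fin 3) (z : ℝ) :
    (commutePolicy i).next ⟨routeCenter a + clampUnit z / 24, routeCenter_add_mem _ _⟩ = a := by
  have h := abs_le.1 (abs_clampUnit_le z)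
  simp only [commutePolicy]
  fin_cases a
  · rw [if_pos]
    · rfl
    · rw [abs_le]; simp [routeCenter]; constructor <;> linarith
  · rw [if_neg, if_pos]
    · rfl
    · rw [lt_abs]; simp [routeCenter]; left; linarith
    · rw [abs_le]; simp [routeCenter]; intro; linarith
  · rw [if_neg, if_neg]
    · rfl
    · rw [not_lt, abs_le]; simp [routeCenter]; constructor <;> linarith
    · rw [abs_le]; simp [routeCenter]; intro; linarith

lemma commutePolicy_state_tokenReward (i : Fin 3) (t : ℕ) :
    (commutePolicy (P 0 i)).toStateful.state (tokenReward P Y R) t = P t i := by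
  induction t with
  | zero => rfl
  | succ t ih =>
    rw [StatefulPolicy.state, ih]
    simp only [ReactivePolicy.toStateful, id, tokenReward, commutePolicy_next_routeCenter,
      Equiv.symm_apply_apply]

lemma commutePolicy_total_tokenReward (T : ℕ) :
    (commutePolicy (P 0 0)).toStateful.total (tokenReward P Y R) T =
      ∑ t ∈ Finset.range T,
        (routeCenter (P (t + 1) 0) + clampUnit ((Y t + 1) / R) / 24) := by
  refine Finset.sum_congr rfl fun t _ => ?_
  have : (commutePolicy (P 0 0)).toStateful.action (tokenReward P Y R) t = P t 0 :=
    commutePolicy_state_tokenReward 0 t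
  rw [this]
  simp [tokenReward]

variable (A : PlayerAlgorithm.{u} 3)

lemma PlayerAlgorithm.history_congr {n : ℕ} (A : PlayerAlgorithm.{u} n) {r r' : RewardSeq n}
    (ω : A.Ω) {t : ℕ}
    (h : ∀ u < t, r' u (A.action r u ω) = r u (A.action r u ω)) :
    A.history r' ω t = A.history r ω t := by
  induction t with
  | zero => rfl
  | succ t ih =>
    have ih := ih fun u hu => h u (hu.trans t.lt_succ_self)
    have ht := h t t.lt_succ_self
    rw [PlayerAlgorithm.action] at ht
    rw [PlayerAlgorithm.history, PlayerAlgorithm.history, ih, ht]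

/-- The token at the action played on round `t`. -/
noncomputable def playedToken (P : ℕ → Equiv.Perm (Fin 3)) (Y : ℕ → ℝ) (R : ℝ) (ω : A.Ω) (t : ℕ) :
    Fin 3 :=
  (P t).symm (A.action (tokenReward P Y R) t ω)

variable {A} {ω : A.Ω}

lemma tokenReward_action (t : ℕ) :
    (tokenReward P Y R t (A.action (tokenReward P Y R) t ω) : ℝ) =
      routeCenter (P (t + 1) (playedToken A P Y R ω t)) +
        clampUnit ((Y t + if playedToken A P Y R ω t = 0 then 1 else 0) / R) / 24 := rfl

/-- If the player has been at token `0` since round `s`, then exchanging token `0` with another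
token from round `s` on and raising the offset by one unit from then on goes unnoticed. -/
lemma action_eq_of_exchange {s t : ℕ} {k : Fin 3} (hk : k ≠ 0)
    (hP : ∀ u ≤ t, P' u = if s ≤ u then P u * Equiv.swap 0 k else P u)
    (hY : ∀ u ≤ t, Y' u = Y u + if s ≤ u then 1 else 0)
    (hrun : ∀ u, s ≤ u → u ≤ t → playedToken A P Y R ω u = 0)
    (hpre : ∀ u, u + 1 = s → playedToken A P Y R ω u ≠ 0 ∧ playedToken A P Y R ω u ≠ k)
    {u : ℕ} (hu : u ≤ t) :
    A.action (tokenReward P' Y' R) u ω = A.action (tokenReward P Y R) u ω := by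
  unfold PlayerAlgorithm.action
  rw [A.history_congr ω]
  intro v hv
  apply Subtype.ext
  rw [tokenReward_action]
  simp only [tokenReward]
  set x := A.action (tokenReward P Y R) v ω with hx
  have hi : playedToken A P Y R ω v = (P v).symm x := rfl
  have hvt : v ≤ t := by omega
  rw [hP v hvt, hP (v + 1) (by omega), hY v hvt]
  by_cases hsv : s ≤ v
  · have h0 := hrun v hsv hvt
    rw [if_pos hsv, if_pos (by omega : s ≤ v + 1), if_pos hsv, h0]
    have : (P v * Equiv.swap 0 k).symm x = k := by
      have : (P v * Equiv.swap 0 k).symm x = Equiv.swap 0 k ((P v).symm x) := rfl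
      rw [this, ← hi, h0, Equiv.swap_apply_left]
    rw [this]
    simp [hk]
  · rw [if_neg hsv, if_neg hsv, add_zero, hi]
    -- The reward on round `s - 1` already reveals a place on round `s`, but of a token that the
    -- exchange fixes.
    by_cases hs : s = v + 1
    · have h := hpre v hs.symm
      rw [hi] at h
      rw [if_pos hs.le, Equiv.Perm.mul_apply, Equiv.swap_apply_of_ne_of_ne h.1 h.2]
    · rw [if_neg (by omega)]

lemma playedToken_exchange {s t : ℕ} {k : Fin 3} (hk : k ≠ 0)
    (hP : ∀ u ≤ t, P' u = if s ≤ u then P u * Equiv.swap 0 k else P u)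
    (hY : ∀ u ≤ t, Y' u = Y u + if s ≤ u then 1 else 0)
    (hrun : ∀ u, s ≤ u → u ≤ t → playedToken A P Y R ω u = 0)
    (hpre : ∀ u, u + 1 = s → playedToken A P Y R ω u ≠ 0 ∧ playedToken A P Y R ω u ≠ k)
    {u : ℕ} (hu : u ≤ t) :
    playedToken A P' Y' R ω u = if s ≤ u then k else playedToken A P Y R ω u := by
  rw [playedToken, action_eq_of_exchange hk hP hY hrun hpre hu, hP u hu]
  split_ifs with h
  · have : (P u * Equiv.swap 0 k).symm (A.action (tokenReward P Y R) u ω) =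
        Equiv.swap 0 k (playedToken A P Y R ω u) := rfl
    rw [this, hrun u h hu, Equiv.swap_apply_left]
  · rfl

/-- Rewards seen before round `t` reveal placements only up to round `t`. -/
lemma playedToken_congr {t : ℕ} (hP : ∀ u ≤ t, P' u = P u) :
    playedToken A P' Y R ω t = playedToken A P Y R ω t := by
  rw [playedToken, playedToken, hP t le_rfl]
  unfold PlayerAlgorithm.action
  rw [A.history_congr ω]
  intro v hv
  apply Subtype.ext
  simp only [tokenReward]
  rw [hP v hv.le, hP (v + 1) hv]

end HiddenTokens

/-! ### Maximal constant runs. -/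

section Runs

/-- The first round of the constant run of `i` that ends on round `t`. -/
noncomputable def runStart (i : ℕ → Fin 3) (t : ℕ) : ℕ :=
  sInf {s | s ≤ t ∧ ∀ u, s ≤ u → u ≤ t → i u = i t}

lemma runStart_mem (i : ℕ → Fin 3) (t : ℕ) :
    runStart i t ∈ {s | s ≤ t ∧ ∀ u, s ≤ u → u ≤ t → i u = i t} :=
  Nat.sInf_mem ⟨t, le_rfl, fun u h1 h2 => by rw [le_antisymm h2 h1]⟩

lemma runStart_eq_of {i : ℕ → Fin 3} {s t : ℕ} (hst : s ≤ t)
    (hrun : ∀ u, s ≤ u → u ≤ t → i u = i t) (hpre : ∀ u, u + 1 = s → i u ≠ i t) :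
    runStart i t = s := by
  refine le_antisymm (Nat.sInf_le ⟨hst, hrun⟩) ?_
  by_contra! h
  exact hpre (s - 1) (by omega) ((runStart_mem i t).2 _ (by omega) (by omega))

lemma ne_of_succ_eq_runStart {i : ℕ → Fin 3} {t u : ℕ} (hu : u + 1 = runStart i t) :
    i u ≠ i t := by
  intro h
  have hm := runStart_mem i t
  have : runStart i t ≤ u := Nat.sInf_le ⟨by have := hm.1; omega, fun v h1 h2 => by
    rcases h1.eq_or_lt with rfl | h1
    · exact h
    · exact hm.2 v (by omega) h2⟩
  omega

end Runs

/-! ### The random instance and its two symmetries. -/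

section RandomInstance

/-- A sample of the random instance: where the tokens are on each of the rounds `0, …, T`, and the
noise at each node of the dyadic tree of depth `L`. -/
abbrev Sample (L N T : ℕ) : Type :=
  (Fin (T + 1) → Equiv.Perm (Fin 3)) × (Fin (L + 1) × Fin (2 ^ L) → Fin (N + 1))

namespace Sample

variable {L N T : ℕ}

/-- The places of the tokens on round `t ≤ T`. -/
def placement (w : Sample L N T) (t : ℕ) : Equiv.Perm (Fin 3) := w.1 (Fin.ofNat (T + 1) t)

/-- The sum of the noise on the path to leaf `t`, minus a constant. -/
noncomputable def offset (c : ℝ) (w : Sample L N T) (t : ℕ) : ℝ :=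
  ∑ l, ((w.2 (dyadicNode L t l) : ℕ) : ℝ) - c

/-- Uniform placements and independent geometric noise. -/
noncomputable def weight (q : ℝ) (w : Sample L N T) : ℝ :=
  (Fintype.card (Fin (T + 1) → Equiv.Perm (Fin 3)) : ℝ)⁻¹ * ∏ v, truncGeom q N (w.2 v)

/-- The rewards in a sample. -/
noncomputable def reward (c R : ℝ) (w : Sample L N T) : RewardSeq 3 :=
  tokenReward w.placement (w.offset c) R

/-- The token at the action played in a sample. -/
noncomputable def played (A : PlayerAlgorithm.{u} 3) (c R : ℝ) (ω : A.Ω) (w : Sample L N T)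
    (t : ℕ) : Fin 3 :=
  playedToken A w.placement (w.offset c) R ω t

/-- Exchange token `0` with token `k` and raise the offset by one unit from round `s` on. -/
def exchange (s : ℕ) (k : Fin 3) (w : Sample L N T) : Sample L N T :=
  (fun u => if s ≤ u then w.1 u * Equiv.swap 0 k else w.1 u,
    fun v => w.2 v + if IsMaximalAfter L s v then 1 else 0)

/-- Adding one in `Fin (N + 1)` wraps around, so injectivity needs no condition on the noise; the
effect on offsets and weights does. -/
lemma exchange_injective (s : ℕ) (k : Fin 3) :
    Function.Injective (exchange s k : Sample L N T → Sample L N T) := by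
  rintro ⟨σ, ξ⟩ ⟨σ', ξ'⟩ h
  have h1 := congrArg Prod.fst h
  have h2 := congrArg Prod.snd h
  refine Prod.ext (funext fun u => ?_) (funext fun v => ?_)
  · have := congrFun h1 u
    simp only [exchange] at this
    split_ifs at this with hs
    · exact mul_right_cancel this
    · exact this
  · exact add_right_cancel (congrFun h2 v)

lemma val_ofNat_of_le {t : ℕ} (ht : t ≤ T) : ((Fin.ofNat (T + 1) t : Fin (T + 1)) : ℕ) = t := by
  simp [Fin.ofNat, Nat.mod_eq_of_lt (Nat.lt_succ_of_le ht)]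

lemma placement_exchange (s : ℕ) (k : Fin 3) (w : Sample L N T) {t : ℕ} (ht : t ≤ T) :
    (w.exchange s k).placement t =
      if s ≤ t then w.placement t * Equiv.swap 0 k else w.placement t := by
  simp only [placement, exchange, val_ofNat_of_le ht]

lemma offset_exchange (c : ℝ) (s : ℕ) (k : Fin 3) {w : Sample L N T}
    (hw : ∀ v, w.2 v ≠ Fin.last N) {t : ℕ} (ht : t < 2 ^ L) :
    (w.exchange s k).offset c t = w.offset c t + if s ≤ t then 1 else 0 := by
  rw [← sum_isMaximalAfter_path ht, offset, offset, sub_add_eq_add_sub, ← Finset.sum_add_distrib]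
  congr 1
  refine Finset.sum_congr rfl fun l _ => ?_
  simp only [exchange]
  split_ifs
  · rw [Fin.val_add_one_of_lt (Fin.lt_last_iff_ne_last.2 (hw _))]
    push_cast
    rfl
  · simp

variable {q : ℝ}

lemma weight_pos (hq : 0 < q) (w : Sample L N T) : 0 < w.weight q :=
  mul_pos (inv_pos.2 (Nat.cast_pos.2 Fintype.card_pos))
    (Finset.prod_pos fun _ _ => truncGeom_pos hq _)

lemma weight_nonneg (hq : 0 < q) (w : Sample L N T) : 0 ≤ w.weight q := (weight_pos hq w).le

lemma weight_exchange_ge (hq : 0 < q) (hq1 : q ≤ 1) (s : ℕ) (k : Fin 3) {w : Sample L N T}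
    (hw : ∀ v, w.2 v ≠ Fin.last N) :
    q ^ (L + 1) * w.weight q ≤ (w.exchange s k).weight q := by
  have h : ∀ v, truncGeom q N ((w.exchange s k).2 v) =
      (if IsMaximalAfter L s v then q else 1) * truncGeom q N (w.2 v) := by
    intro v
    simp only [exchange]
    split_ifs
    · exact truncGeom_add_one (hw v)
    · simp
  have e : (w.exchange s k).weight q =
      q ^ (Finset.univ.filter (IsMaximalAfter L s)).card * w.weight q := by
    rw [weight, weight, Finset.prod_congr rfl fun v _ => h v, Finset.prod_mul_distrib,
      Finset.prod_ite, Finset.prod_const, Finset.prod_const_one]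
    ring
  rw [e]
  exact mul_le_mul_of_nonneg_right
    (pow_le_pow_of_le_one hq.le hq1 (card_isMaximalAfter_le L s)) (weight_nonneg hq w)

lemma sum_weight_mul (g : (Fin (L + 1) × Fin (2 ^ L) → Fin (N + 1)) → ℝ) :
    ∑ w : Sample L N T, w.weight q * g w.2 = ∑ ξ, (∏ v, truncGeom q N (ξ v)) * g ξ := by
  rw [Fintype.sum_prod_type]
  simp only [weight, mul_assoc, ← Finset.mul_sum, Finset.sum_const, Finset.card_univ,
    nsmul_eq_mul]
  have hc : (Fintype.card (Fin (T + 1) → Equiv.Perm (Fin 3)) : ℝ) ≠ 0 :=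
    Nat.cast_ne_zero.2 Fintype.card_ne_zero
  exact inv_mul_cancel_left₀ hc _

lemma sum_weight (hq : 0 < q) : ∑ w : Sample L N T, w.weight q = 1 := by
  have := sum_weight_mul (L := L) (N := N) (T := T) (q := q) fun _ => 1
  simpa [sum_prod_weights (sum_truncGeom hq)] using this

lemma sum_weight_exists_last_le (hq : 0 < q) :
    ∑ w : Sample L N T with ∃ v, w.2 v = Fin.last N, w.weight q ≤
      Fintype.card (Fin (L + 1) × Fin (2 ^ L)) * q ^ N := by
  have h1 : ∀ v : Fin (L + 1) × Fin (2 ^ L),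
      ∑ w : Sample L N T, w.weight q * (if w.2 v = Fin.last N then 1 else 0) ≤ q ^ N := by
    intro v
    rw [sum_weight_mul fun ξ => if ξ v = Fin.last N then 1 else 0,
      sum_prod_weights_coord (sum_truncGeom hq) v fun a => if a = Fin.last N then 1 else 0]
    simpa using truncGeom_last_le hq
  calc ∑ w : Sample L N T with ∃ v, w.2 v = Fin.last N, w.weight q
      ≤ ∑ w : Sample L N T, ∑ v, w.weight q * (if w.2 v = Fin.last N then 1 else 0) := by
        rw [Finset.sum_filter]
        refine Finset.sum_le_sum fun w _ => ?_
        have hn : ∀ v ∈ Finset.univ,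
            0 ≤ w.weight q * (if w.2 v = Fin.last N then (1 : ℝ) else 0) :=
          fun v _ => mul_nonneg (weight_nonneg hq w) (by split_ifs <;> norm_num)
        split_ifs with h
        · obtain ⟨v, hv⟩ := h
          simpa [hv] using Finset.single_le_sum hn (Finset.mem_univ v)
        · exact Finset.sum_nonneg hn
    _ = ∑ v, ∑ w : Sample L N T, w.weight q * (if w.2 v = Fin.last N then 1 else 0) :=
        Finset.sum_comm
    _ ≤ ∑ _v : Fin (L + 1) × Fin (2 ^ L), q ^ N := Finset.sum_le_sum fun v _ => h1 v
    _ = _ := by simp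

variable {A : PlayerAlgorithm.{u} 3} {c R : ℝ} {ω : A.Ω}

lemma played_exchange {t : ℕ} (htT : t ≤ T) (htL : t < 2 ^ L) {k : Fin 3} {w : Sample L N T}
    (hw : ∀ v, w.2 v ≠ Fin.last N) (h0 : w.played A c R ω t = 0) (hk : k ≠ 0)
    (hpre : ∀ u, u + 1 = runStart (w.played A c R ω) t → w.played A c R ω u ≠ k)
    {u : ℕ} (hu : u ≤ t) :
    (w.exchange (runStart (w.played A c R ω) t) k).played A c R ω u =
      if runStart (w.played A c R ω) t ≤ u then k else w.played A c R ω u :=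
  playedToken_exchange hk
    (fun _ hu => placement_exchange _ _ _ (hu.trans htT))
    (fun _ hu => offset_exchange _ _ _ hw (hu.trans_lt htL))
    (fun _ h1 h2 => ((runStart_mem (w.played A c R ω) t).2 _ h1 h2).trans h0)
    (fun u hu => ⟨h0 ▸ ne_of_succ_eq_runStart hu, hpre u hu⟩) hu

/-- The player cannot tell that it is at token `0`. -/
lemma sum_weight_played_eq_zero_le (hq : 0 < q) (hq1 : q ≤ 1) (hqL : 1 / 2 ≤ q ^ (L + 1)) {t : ℕ}
    (htT : t ≤ T) (htL : t < 2 ^ L) :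
    ∑ w : Sample L N T with w.played A c R ω t = 0, w.weight q ≤
      2 * ∑ w : Sample L N T with w.played A c R ω t ≠ 0, w.weight q +
        ∑ w : Sample L N T with ∃ v, w.2 v = Fin.last N, w.weight q := by
  classical
  let good : Finset (Sample L N T) :=
    Finset.univ.filter fun w => w.played A c R ω t = 0 ∧ ∀ v, w.2 v ≠ Fin.last N
  let start : Sample L N T → ℕ := fun w => runStart (w.played A c R ω) t
  -- A token other than `0` and than the one played just before the run, so that the run of the
  -- exchanged sample also starts at `start w`.
  let other : Sample L N T → Fin 3 := fun w =>
    if w.played A c R ω (start w - 1) = 1 then 2 else 1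
  let Φ : Sample L N T → Sample L N T := fun w => w.exchange (start w) (other w)
  have other_ne : ∀ w, other w ≠ 0 := fun w => by
    simp only [other]; split_ifs <;> decide
  have pre_ne : ∀ w, ∀ u, u + 1 = start w → w.played A c R ω u ≠ other w := by
    intro w u hu
    have : start w - 1 = u := by omega
    simp only [other, this]
    split_ifs with h
    · rw [h]; decide
    · exact h
  have played_Φ : ∀ w ∈ good, ∀ u ≤ t, (Φ w).played A c R ω u =
      if start w ≤ u then other w else w.played A c R ω u := by
    intro w hw u hu
    have hw := (Finset.mem_filter.1 hw).2
    exact played_exchange htT htL hw.2 hw.1 (other_ne w) (pre_ne w) hu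
  have start_le : ∀ w, start w ≤ t := fun w => (runStart_mem (w.played A c R ω) t).1
  have played_Φ_t : ∀ w ∈ good, (Φ w).played A c R ω t = other w := fun w hw => by
    rw [played_Φ w hw t le_rfl, if_pos (start_le w)]
  have start_Φ : ∀ w ∈ good, start (Φ w) = start w := by
    intro w hw
    refine runStart_eq_of (start_le w) (fun u h1 h2 => ?_) fun u hu => ?_
    · rw [played_Φ w hw u h2, played_Φ_t w hw, if_pos h1]
    · have hut : u ≤ t := by have := start_le w; omega
      rw [played_Φ w hw u hut, played_Φ_t w hw, if_neg (by omega)]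
      exact pre_ne w u hu
  -- Both parameters of the exchange can be read off the tokens played in the image.
  have inj : Set.InjOn Φ good := by
    intro w hw w' hw' h
    have hs : start w = start w' := by rw [← start_Φ w hw, ← start_Φ w' hw', h]
    have ho : other w = other w' := by rw [← played_Φ_t w hw, ← played_Φ_t w' hw', h]
    simp only [Φ, hs, ho] at h
    exact exchange_injective _ _ h
  have h1 : ∑ w ∈ good, w.weight q ≤
      2 * ∑ w : Sample L N T with w.played A c R ω t ≠ 0, w.weight q := by
    calc ∑ w ∈ good, w.weight q ≤ ∑ w ∈ good, 2 * (Φ w).weight q := by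
          refine Finset.sum_le_sum fun w hw => ?_
          have h := weight_exchange_ge hq hq1 (start w) (other w) (Finset.mem_filter.1 hw).2.2
          have := mul_le_mul_of_nonneg_right hqL (weight_nonneg hq w)
          simp only [Φ]
          linarith
      _ = 2 * ∑ w ∈ good.image Φ, w.weight q := by
          rw [← Finset.mul_sum, Finset.sum_image inj]
      _ ≤ _ := by
          refine mul_le_mul_of_nonneg_left (Finset.sum_le_sum_of_subset_of_nonneg ?_
            fun w _ _ => weight_nonneg hq w) zero_le_two
          intro w hw
          obtain ⟨w', hw', rfl⟩ := Finset.mem_image.1 hw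
          rw [Finset.mem_filter, played_Φ_t w' hw']
          exact ⟨Finset.mem_univ _, other_ne w'⟩
  refine le_trans (Finset.sum_le_sum_of_subset_of_nonneg
    (t := good ∪ Finset.univ.filter fun w => ∃ v, w.2 v = Fin.last N) ?_
    fun w _ _ => weight_nonneg hq w) ?_
  · intro w hw
    have hw := (Finset.mem_filter.1 hw).2
    by_cases h : ∃ v, w.2 v = Fin.last N
    · exact Finset.mem_union_right _ (Finset.mem_filter.2 ⟨Finset.mem_univ _, h⟩)
    · simp only [not_exists] at h
      simp [good, h, hw]
  · refine le_trans (le_of_le_of_eq (le_add_of_nonneg_right ?_)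
      (Finset.sum_union_inter (s₁ := good))) (by gcongr)
    exact Finset.sum_nonneg fun w _ => weight_nonneg hq w

/-- With `p` the right-hand side, `1 - p ≤ 2 * p + 1/2`. -/
lemma sum_weight_played_ne_zero_ge (hq : 0 < q) (hq1 : q ≤ 1) (hqL : 1 / 2 ≤ q ^ (L + 1))
    (hN : Fintype.card (Fin (L + 1) × Fin (2 ^ L)) * q ^ N ≤ 1 / 2) {t : ℕ}
    (htT : t ≤ T) (htL : t < 2 ^ L) :
    1 / 6 ≤ ∑ w : Sample L N T with w.played A c R ω t ≠ 0, w.weight q := by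
  have h1 := sum_weight_played_eq_zero_le (A := A) (c := c) (R := R) (ω := ω) (N := N)
    hq hq1 hqL htT htL
  have h2 := sum_weight_exists_last_le (L := L) (N := N) (T := T) hq
  have h3 := sum_weight (L := L) (N := N) (T := T) hq
  rw [← Finset.sum_filter_add_sum_filter_not _ fun w => w.played A c R ω t = 0] at h3
  simp only [← ne_eq] at h3
  linarith

/-- Exchange the next places of token `0` and of the token the player is at. -/
noncomputable def swapNext (A : PlayerAlgorithm.{u} 3) (c R : ℝ) (ω : A.Ω) (t : ℕ)
    (w : Sample L N T) : Sample L N T :=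
  (Function.update w.1 (Fin.ofNat (T + 1) (t + 1))
    (w.placement (t + 1) * Equiv.swap 0 (w.played A c R ω t)), w.2)

lemma placement_swapNext (t : ℕ) (w : Sample L N T) :
    (w.swapNext A c R ω t).placement (t + 1) =
      w.placement (t + 1) * Equiv.swap 0 (w.played A c R ω t) := by
  simp [placement, swapNext]

lemma played_swapNext {t : ℕ} (ht : t < T) (w : Sample L N T) :
    (w.swapNext A c R ω t).played A c R ω t = w.played A c R ω t := by
  refine playedToken_congr (Y := w.offset c) fun u hu => ?_
  have h : (Fin.ofNat (T + 1) u : Fin (T + 1)) ≠ Fin.ofNat (T + 1) (t + 1) := by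
    intro h
    have := congrArg Fin.val h
    rw [val_ofNat_of_le (by omega), val_ofNat_of_le (by omega)] at this
    omega
  exact Function.update_of_ne h _ _

/-- The token played on round `t` ignores the placement on round `t + 1`, so the same swap is
applied twice. -/
lemma swapNext_involutive {t : ℕ} (ht : t < T) :
    Function.Involutive (swapNext A c R ω t : Sample L N T → Sample L N T) := by
  intro w
  have h : (swapNext A c R ω t (w.swapNext A c R ω t)).1 = w.1 := by
    conv_lhs => rw [swapNext]
    rw [placement_swapNext, played_swapNext ht, mul_assoc, Equiv.swap_mul_self, mul_one]
    simp [swapNext, placement]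
  exact Prod.ext h rfl

/-- On average, the center of the reward does not depend on the player. -/
lemma sum_weight_routeCenter_sub {t : ℕ} (ht : t < T) :
    ∑ w : Sample L N T, w.weight q * (routeCenter (w.placement (t + 1) 0) -
      routeCenter (w.placement (t + 1) (w.played A c R ω t))) = 0 := by
  have h := Equiv.sum_comp (swapNext_involutive (A := A) (c := c) (R := R) (ω := ω) (L := L)
    (N := N) ht).toPerm fun w : Sample L N T =>
      w.weight q * (routeCenter (w.placement (t + 1) 0) -
        routeCenter (w.placement (t + 1) (w.played A c R ω t)))
  have hw : ∀ w : Sample L N T, (w.swapNext A c R ω t).weight q = w.weight q := fun w => rfl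
  simp only [Function.Involutive.coe_toPerm, hw, placement_swapNext, played_swapNext ht,
    Equiv.Perm.mul_apply, Equiv.swap_apply_left, Equiv.swap_apply_right] at h
  -- The involution preserves weights and negates the summand, so the sum equals its negative.
  rw [← neg_eq_self, ← Finset.sum_neg_distrib]
  rw [← h]
  refine Finset.sum_congr rfl fun w _ => ?_
  ring

/-- The nodes on a path are distinct, so their noises are independent and the variances add. -/
lemma sum_weight_offset_sq_le (hq : 0 < q) (hq1 : q < 1) (t : ℕ) :
    ∑ w : Sample L N T, w.weight q *
        w.offset ((L + 1 : ℕ) * ∑ a, truncGeom q N a * ((a : ℕ) : ℝ)) t ^ 2 ≤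
      (L + 1 : ℕ) * (3 / (1 - q) ^ 2) := by
  have h := sum_prod_weights_variance_le (sum_truncGeom hq) (fun a : Fin (N + 1) => ((a : ℕ) : ℝ))
    (dyadicNode_injective L t)
  rw [Fintype.card_fin] at h
  have e := sum_weight_mul (T := T) (q := q)
    fun ξ : Fin (L + 1) × Fin (2 ^ L) → Fin (N + 1) =>
      (∑ l, ((ξ (dyadicNode L t l) : ℕ) : ℝ) -
        (L + 1 : ℕ) * ∑ a, truncGeom q N a * ((a : ℕ) : ℝ)) ^ 2
  simp only [offset]
  rw [e]
  exact h.trans (mul_le_mul_of_nonneg_left (truncGeom_second_moment_le hq hq1) (by positivity))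

end Sample

end RandomInstance

/-! ### Measurability of the play; histories take finitely many values. -/

section Measurability

namespace PlayerAlgorithm

variable {n : ℕ} (A : PlayerAlgorithm.{u} n) (r : RewardSeq n)

lemma finite_range_history (t : ℕ) : (Set.range fun ω => A.history r ω t).Finite := by
  induction t with
  | zero => exact (Set.finite_singleton []).subset (by rintro _ ⟨ω, rfl⟩; rfl)
  | succ t ih =>
    refine (ih.image2 (fun h a => h ++ [(a, r t a)]) (Set.finite_univ (α := Fin n))).subset ?_
    rintro _ ⟨ω, rfl⟩
    exact ⟨_, ⟨ω, rfl⟩, A.choose ω (A.history r ω t), Set.mem_univ _, rfl⟩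

lemma measurableSet_history_eq (t : ℕ) (h : List (Fin n × unitInterval)) :
    MeasurableSet {ω | A.history r ω t = h} := by
  induction t generalizing h with
  | zero => exact MeasurableSet.const ([] = h)
  | succ t ih =>
    have e : {ω | A.history r ω (t + 1) = h} =
        ⋃ g ∈ Set.range fun ω => A.history r ω t, ⋃ a : Fin n,
          ({ω | A.history r ω t = g} ∩ {ω | A.choose ω g = a}) ∩
            {_ω | g ++ [(a, r t a)] = h} := by
      ext ω
      simp only [Set.mem_ofPred_eq, Set.mem_iUnion, Set.mem_inter_iff, history]
      constructor
      · intro hω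
        exact ⟨_, ⟨ω, rfl⟩, _, ⟨rfl, rfl⟩, hω⟩
      · rintro ⟨g, -, a, ⟨h1, h2⟩, h3⟩
        rw [h1, h2, h3]
    rw [e]
    refine (A.finite_range_history r t).measurableSet_biUnion fun g _ =>
      MeasurableSet.iUnion fun a => ((ih g).inter ?_).inter (MeasurableSet.const _)
    exact A.measurable_choose g (measurableSet_singleton a)

lemma measurable_action (t : ℕ) : Measurable (A.action r t) := by
  refine measurable_to_countable' fun a => ?_
  have e : A.action r t ⁻¹' {a} = ⋃ g ∈ Set.range fun ω => A.history r ω t,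
      {ω | A.history r ω t = g} ∩ {ω | A.choose ω g = a} := by
    ext ω
    simp only [Set.mem_preimage, Set.mem_singleton_iff, Set.mem_ofPred_eq, Set.mem_iUnion,
      Set.mem_inter_iff, action]
    constructor
    · intro hω
      exact ⟨_, ⟨ω, rfl⟩, rfl, hω⟩
    · rintro ⟨g, -, h1, h2⟩
      rw [h1, h2]
  rw [e]
  exact (A.finite_range_history r t).measurableSet_biUnion fun g _ =>
    (A.measurableSet_history_eq r t g).inter (A.measurable_choose g (measurableSet_singleton a))

lemma integrable_total (T : ℕ) :
    Integrable (fun ω => ∑ t ∈ Finset.range T, (r t (A.action r t ω) : ℝ)) A.μ := by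
  refine integrable_finsetSum _ fun t _ => Integrable.of_bound (C := 1) ?_ ?_
  · exact ((measurable_of_countable fun a => (r t a : ℝ)).comp
      (A.measurable_action r t)).aestronglyMeasurable
  · refine Filter.Eventually.of_forall fun ω => ?_
    rw [Real.norm_of_nonneg (r t _).2.1]
    exact (r t _).2.2

end PlayerAlgorithm

end Measurability

/-! ### Averaging and choice of parameters. -/

section LowerBound

namespace Sample

variable {L N T : ℕ} {A : PlayerAlgorithm.{u} 3} {ω : A.Ω} {q D : ℝ}

/-- The mean of the offsets, before centering. -/
noncomputable def noiseMean (q : ℝ) (L N : ℕ) : ℝ :=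
  (L + 1 : ℕ) * ∑ a, truncGeom q N a * ((a : ℕ) : ℝ)

/-- Being off token `0` gains at least `1/6`, and truncation costs at most `1/12` by Chebyshev, both
in units of `1 / (24 * (1 + D))`. -/
lemma sum_weight_round_regret_ge (hq : 0 < q) (hq1 : q < 1) (hqL : 1 / 2 ≤ q ^ (L + 1))
    (hN : Fintype.card (Fin (L + 1) × Fin (2 ^ L)) * q ^ N ≤ 1 / 2) (hD : 0 < D)
    (hvar : (L + 1 : ℕ) * (3 / (1 - q) ^ 2) ≤ D ^ 2 / 12) (hTL : T ≤ 2 ^ L)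
    {t : ℕ} (ht : t < T) :
    1 / (288 * (1 + D)) ≤ ∑ w : Sample L N T, w.weight q *
      ((routeCenter (w.placement (t + 1) 0) +
          clampUnit ((w.offset (noiseMean q L N) t + 1) / (1 + D)) / 24) -
        w.reward (noiseMean q L N) (1 + D) t
          (A.action (w.reward (noiseMean q L N) (1 + D)) t ω)) := by
  set c := noiseMean q L N with hc
  have h1 := sum_weight_routeCenter_sub (A := A) (c := c) (R := 1 + D) (ω := ω) (L := L)
    (N := N) (q := q) ht
  have h2 := sum_weight_played_ne_zero_ge (A := A) (c := c) (R := 1 + D) (ω := ω) (L := L)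
    (N := N) hq hq1.le hqL hN ht.le (ht.trans_le hTL)
  have h3 := (sum_weight_offset_sq_le (L := L) (N := N) (T := T) hq hq1 t).trans hvar
  rw [← noiseMean, ← hc] at h3
  have h4 : ∀ w : Sample L N T,
      w.weight q * (routeCenter (w.placement (t + 1) 0) -
          routeCenter (w.placement (t + 1) (w.played A c (1 + D) ω t))) +
        1 / (24 * (1 + D)) * ((if w.played A c (1 + D) ω t ≠ 0 then w.weight q else 0) -
          w.weight q * w.offset c t ^ 2 / D ^ 2) ≤
      w.weight q * ((routeCenter (w.placement (t + 1) 0) +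
          clampUnit ((w.offset c t + 1) / (1 + D)) / 24) -
        w.reward c (1 + D) t (A.action (w.reward c (1 + D)) t ω)) := by
    intro w
    have e : (w.reward c (1 + D) t (A.action (w.reward c (1 + D)) t ω) : ℝ) =
      routeCenter (w.placement (t + 1) (w.played A c (1 + D) ω t)) +
        clampUnit ((w.offset c t + if w.played A c (1 + D) ω t = 0 then 1 else 0) / (1 + D)) / 24 :=
      tokenReward_action t
    have hw := weight_nonneg hq w
    rw [e]
    by_cases h0 : w.played A c (1 + D) ω t = 0
    · rw [if_pos h0, if_neg (not_not.2 h0), h0]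
      have : 0 ≤ 1 / (24 * (1 + D)) * (w.weight q * w.offset c t ^ 2 / D ^ 2) := by positivity
      linarith
    · rw [if_neg h0, if_pos h0]
      have h := mul_le_mul_of_nonneg_left (clampUnit_increment_ge hD (w.offset c t)) hw
      have e2 : 1 / (24 * (1 + D)) * (w.weight q - w.weight q * w.offset c t ^ 2 / D ^ 2) =
          w.weight q * (1 / (1 + D) * (1 - w.offset c t ^ 2 / D ^ 2)) / 24 := by
        field_simp
      rw [e2]
      linarith
  refine le_trans ?_ (Finset.sum_le_sum fun w _ => h4 w)
  rw [Finset.sum_add_distrib, h1, zero_add, ← Finset.mul_sum, Finset.sum_sub_distrib,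
    ← Finset.sum_filter, ← Finset.sum_div]
  have h5 : (∑ w : Sample L N T, w.weight q * w.offset c t ^ 2) / D ^ 2 ≤ 1 / 12 := by
    rw [div_le_iff₀ (by positivity)]
    linarith
  calc 1 / (288 * (1 + D)) = 1 / (24 * (1 + D)) * (1 / 12) := by field_simp; norm_num
    _ ≤ _ := mul_le_mul_of_nonneg_left (by linarith) (by positivity)

end Sample

lemma exists_regret_ge {L T : ℕ} (hTL : T ≤ 2 ^ L) (A : PlayerAlgorithm.{u} 3) :
    ∃ r : RewardSeq 3, T * (1 / (288 * (1 + 12 * √(((L + 1 : ℕ) : ℝ) ^ 3)))) ≤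
      expectedRegret (fun i => (commutePolicy i).toStateful) A r T := by
  set D := 12 * √(((L + 1 : ℕ) : ℝ) ^ 3) with hDdef
  have hL : (0 : ℝ) < (L + 1 : ℕ) := by positivity
  have hL1 : (1 : ℝ) ≤ (L + 1 : ℕ) := by exact_mod_cast Nat.succ_pos L
  have hD : 0 < D := by positivity
  -- Bernoulli's inequality then gives `q ^ (L + 1) ≥ 1/2`, and `D` makes `hvar` an equality.
  let q : ℝ := 1 - 1 / (2 * (L + 1 : ℕ))
  have hinv : 1 / (2 * ((L + 1 : ℕ) : ℝ)) ≤ 1 / 2 := by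
    rw [div_le_div_iff₀ (by positivity) (by norm_num)]; linarith
  have hinv0 : 0 < 1 / (2 * ((L + 1 : ℕ) : ℝ)) := by positivity
  have hq : 0 < q := by simp only [q]; linarith
  have hq1 : q < 1 := by simp only [q]; linarith
  have hqL : 1 / 2 ≤ q ^ (L + 1) := by
    have h := one_add_mul_le_pow (a := -(1 / (2 * ((L + 1 : ℕ) : ℝ)))) (by linarith) (L + 1)
    have e : 1 + ((L + 1 : ℕ) : ℝ) * -(1 / (2 * ((L + 1 : ℕ) : ℝ))) = 1 / 2 := by
      field_simp; norm_num
    rwa [e, ← sub_eq_add_neg] at h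
  have hvar : (L + 1 : ℕ) * (3 / (1 - q) ^ 2) ≤ D ^ 2 / 12 := by
    rw [hDdef, mul_pow, Real.sq_sqrt (by positivity)]
    have : 1 - q = 1 / (2 * ((L + 1 : ℕ) : ℝ)) := by simp only [q]; ring
    rw [this]
    apply le_of_eq
    field_simp
    norm_num
  -- The truncation level may be as large as needed, since the final bound does not involve `N`.
  obtain ⟨N, hN⟩ : ∃ N : ℕ, Fintype.card (Fin (L + 1) × Fin (2 ^ L)) * q ^ N ≤ 1 / 2 := by
    have hc : (0 : ℝ) < Fintype.card (Fin (L + 1) × Fin (2 ^ L)) :=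
      Nat.cast_pos.2 Fintype.card_pos
    obtain ⟨N, hN⟩ := exists_pow_lt_of_lt_one
      (show (0 : ℝ) < 1 / 2 / Fintype.card (Fin (L + 1) × Fin (2 ^ L)) by positivity) hq1
    exact ⟨N, by rw [lt_div_iff₀ hc] at hN; linarith⟩
  set b := T * (1 / (288 * (1 + D)))
  let r : Sample L N T → RewardSeq 3 := fun w => w.reward (Sample.noiseMean q L N) (1 + D)
  let best : Sample L N T → ℝ := fun w => ∑ t ∈ Finset.range T,
    (routeCenter (w.placement (t + 1) 0) +
      clampUnit ((w.offset (Sample.noiseMean q L N) t + 1) / (1 + D)) / 24)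
  let gain : Sample L N T → A.Ω → ℝ := fun w ω =>
    ∑ t ∈ Finset.range T, (r w t (A.action (r w) t ω) : ℝ)
  have hgain : ∀ w, Integrable (gain w) A.μ := fun w => A.integrable_total (r w) T
  have hbest : ∀ w, best w - ∫ ω, gain w ω ∂A.μ ≤
      expectedRegret (fun i => (commutePolicy i).toStateful) A (r w) T := by
    intro w
    refine sub_le_sub_right ?_ _
    have h : best w = (commutePolicy (w.placement 0 0)).toStateful.total (r w) T :=
      (commutePolicy_total_tokenReward (P := w.placement)
        (Y := w.offset (Sample.noiseMean q L N)) (R := 1 + D) T).symm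
    rw [h]
    exact le_ciSup (f := fun i => (commutePolicy i).toStateful.total (r w) T)
      (Set.finite_range _).bddAbove (w.placement 0 0)
  -- The bound holds for each fixed internal randomness; integrating over `ω` handles randomized
  -- players.
  have hpoint : ∀ ω, b ≤ ∑ w, w.weight q * (best w - gain w ω) := by
    intro ω
    have e : ∑ w, w.weight q * (best w - gain w ω) = ∑ t ∈ Finset.range T,
        ∑ w : Sample L N T, w.weight q *
          ((routeCenter (w.placement (t + 1) 0) +
            clampUnit ((w.offset (Sample.noiseMean q L N) t + 1) / (1 + D)) / 24) -
          r w t (A.action (r w) t ω)) := by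
      rw [Finset.sum_comm]
      refine Finset.sum_congr rfl fun w _ => ?_
      rw [← Finset.mul_sum, Finset.sum_sub_distrib]
    rw [e]
    refine le_of_eq_of_le ?_ (Finset.card_nsmul_le_sum _ _ (1 / (288 * (1 + D))) fun t ht =>
      Sample.sum_weight_round_regret_ge hq hq1 hqL hN hD hvar hTL (Finset.mem_range.1 ht))
    rw [Finset.card_range, nsmul_eq_mul]
  have havg : b ≤ ∑ w, w.weight q * (best w - ∫ ω, gain w ω ∂A.μ) := by
    have hint : ∀ w : Sample L N T, Integrable (fun ω => w.weight q * (best w - gain w ω)) A.μ :=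
      fun w => ((integrable_const _).sub (hgain w)).const_mul _
    calc b = ∫ _ω, b ∂A.μ := by simp
      _ ≤ ∫ ω, ∑ w, w.weight q * (best w - gain w ω) ∂A.μ :=
        integral_mono (integrable_const _) (integrable_finsetSum _ fun w _ => hint w) hpoint
      _ = _ := by
        rw [integral_finsetSum _ fun w _ => hint w]
        refine Finset.sum_congr rfl fun w _ => ?_
        rw [integral_const_mul, integral_sub (integrable_const _) (hgain w)]
        simp
  by_contra! hlt
  have h : ∑ w : Sample L N T, w.weight q * (best w - ∫ ω, gain w ω ∂A.μ) <
      ∑ w : Sample L N T, w.weight q * b :=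
    Finset.sum_lt_sum_of_nonempty Finset.univ_nonempty fun w _ =>
      mul_lt_mul_of_pos_left ((hbest w).trans_lt (hlt (r w))) (Sample.weight_pos hq w)
  rw [← Finset.sum_mul, Sample.sum_weight hq, one_mul] at h
  exact absurd havg (not_le.2 h)

/-- The regret lower bound for the commute policies. -/
lemma commutePolicy_regret_lower_bound :
    ∃ c : ℝ, 0 < c ∧ ∀ T : ℕ, 2 ≤ T → ∀ A : PlayerAlgorithm.{u} 3, ∃ r : RewardSeq 3,
      c * (T / Real.log T ^ (3 / 2 : ℝ)) ≤
        expectedRegret (fun i => (commutePolicy i).toStateful) A r T := by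
  -- Here `3744 = 288 * 13`, from `1 + 12 * x ≤ 13 * x` for `x ≥ 1`, and `5` comes from `L + 1 ≤ 2 +
  -- log T / log 2 ≤ 5 * log T`.
  refine ⟨1 / (3744 * 5 ^ (3 / 2 : ℝ)), by positivity, fun T hT A => ?_⟩
  obtain ⟨r, hr⟩ := exists_regret_ge (Nat.le_pow_clog one_lt_two T) A
  refine ⟨r, le_trans ?_ hr⟩
  set L := Nat.clog 2 T with hLdef
  have hT' : (2 : ℝ) ≤ T := by exact_mod_cast hT
  have hlog2 : (0.6931471803 : ℝ) < Real.log 2 := Real.log_two_gt_d9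
  have hlogT : Real.log 2 ≤ Real.log T := Real.log_le_log two_pos hT'
  have hLlog : ((L + 1 : ℕ) : ℝ) ≤ 5 * Real.log T := by
    have h1 : 2 ^ (L - 1) < T := Nat.pow_pred_clog_lt_self one_lt_two hT
    have hL1 : 1 ≤ L := Nat.clog_pos one_lt_two hT
    have h2 : ((L - 1 : ℕ) : ℝ) * Real.log 2 ≤ Real.log T := by
      rw [← Real.log_pow]
      exact Real.log_le_log (by positivity) (by exact_mod_cast h1.le)
    push_cast [hL1] at h2 ⊢
    nlinarith
  have hsqrt : √(((L + 1 : ℕ) : ℝ) ^ 3) = ((L + 1 : ℕ) : ℝ) ^ (3 / 2 : ℝ) := by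
    rw [Real.sqrt_eq_rpow, ← Real.rpow_natCast, ← Real.rpow_mul (by positivity)]
    norm_num
  have h1 : (1 : ℝ) ≤ ((L + 1 : ℕ) : ℝ) ^ (3 / 2 : ℝ) :=
    Real.one_le_rpow (by exact_mod_cast Nat.succ_pos L) (by norm_num)
  have h2 : ((L + 1 : ℕ) : ℝ) ^ (3 / 2 : ℝ) ≤ 5 ^ (3 / 2 : ℝ) * Real.log T ^ (3 / 2 : ℝ) := by
    rw [← Real.mul_rpow (by norm_num) (by linarith)]
    exact Real.rpow_le_rpow (by positivity) hLlog (by norm_num)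
  have hpos : 0 < Real.log T ^ (3 / 2 : ℝ) := Real.rpow_pos_of_pos (by linarith) _
  rw [hsqrt]
  calc 1 / (3744 * 5 ^ (3 / 2 : ℝ)) * (T / Real.log T ^ (3 / 2 : ℝ))
      = T * (1 / (3744 * (5 ^ (3 / 2 : ℝ) * Real.log T ^ (3 / 2 : ℝ)))) := by field_simp
    _ ≤ _ := mul_le_mul_of_nonneg_left
      (one_div_le_one_div_of_le (by positivity) (by linarith)) (by positivity)

lemma commutePolicy_injective : Function.Injective commutePolicy :=
  fun _ _ h => congrArg ReactivePolicy.init h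

end LowerBound

theorem theorem2 :
    (∃ P : Fin 3 → ReactivePolicy 3, Function.Injective P ∧
      ∃ c : ℝ, 0 < c ∧ ∀ T : ℕ, 2 ≤ T → ∀ A : PlayerAlgorithm.{u} 3, ∃ r : RewardSeq 3,
        c * (T / Real.log T ^ (3 / 2 : ℝ)) ≤ expectedRegret (fun i => (P i).toStateful) A r T) ∧
    (∃ c : ℝ, 0 < c ∧ ∀ T : ℕ, 2 ≤ T → ∀ A : PlayerAlgorithm.{u} 3, ∃ r : RewardSeq 3,
        c * (T / Real.log T ^ (3 / 2 : ℝ)) ≤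
          expectedRegret (fun i => (commutePolicy i).toStateful) A r T) :=
  ⟨⟨commutePolicy, commutePolicy_injective, commutePolicy_regret_lower_bound⟩,
    commutePolicy_regret_lower_bound⟩
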